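/- Let $p$ be an odd prime. For a subset or element $S$ of a Lie algebra write $\mathrm{Id}(S)$ for the ideal it generates; commutators are left-normed. Let $F$ be the largest Lie algebra over $\mathbb F_p$ generated by $z,c_1,c_2,\dots$ such that the $c_i$ commute with each other, every $\mathrm{Id}(c_i)$ is abelian, and $\mathrm{Id}(z)$ is metabelian (its second derived ideal is zero). For a finite set $I=\{i_1<\dots<i_k\}$ of positive integers put $[z,c_I]=[z,c_{i_1},\dots,c_{i_k}]$, so that $[z,c_\varnothing]=z$. Order these elements as follows: for nonempty $I,J$ let $[z,c_I]<[z,c_J]$ if the word $zc_{i_1}\cdots c_{i_k}$ precedes $zc_{j_1}\cdots c_{j_l}$ lexicographically (with $c_1<c_2<\cdots<z$), and let $z$ be the largest element. A *basis commutator* is an element $$c=[[z,c_{I_1}],[z,c_{I_2}],\dots,[z,c_{I_m}]],\qquad m\ge 1,$$ with $I_1,\dots,I_m$ pairwise disjoint finite sets of positive integers and $[z,c_{I_1}]>[z,c_{I_2}]\le[z,c_{I_3}]\le\dots\le[z,c_{I_m}]$; its *type* is $|I_1|+\dots+|I_m|-2m$. Let $J$ be the smallest ideal of $F$ containing * every basis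 commutator $c\ne z$ of type less than $-1$ or more than $1$, and * every basis commutator with $m\ge 2$ in which one of $I_1,I_3,\dots,I_m$ has more than two elements. Let $L=F/J$. **Theorem.** The ideal of $L$ generated by (the image of) $z$ is not nilpotent. -/

import Mathlib

namespace EngelLie

/-- The free generators `z, c₁, c₂, …`; the variable written `c_{i+1}` on paper is `c i`. -/
inductive Gen : Type
  | z : Gen
  | c (i : ℕ) : Gen

section General

variable (R : Type*) [CommRing R] {A : Type*} [LieRing A] [LieAlgebra R A]

/-- `Id(S)`: the smallest Lie ideal containing the set `S`. -/
abbrev idealSpan (S : Set A) : LieIdeal R A := LieSubmodule.lieSpan R A S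

end General

section AlgebraF

variable (p : ℕ)

/-- The free Lie algebra over `𝔽_p` on `z, c₁, c₂, …`. -/
abbrev FreeL : Type := FreeLieAlgebra (ZMod p) Gen

/-- The relations defining `F`: the `c_i` commute with each other, every `Id(c_i)` is abelian
(`[Id(c_i), Id(c_i)] = 0`), and `Id(z)` is metabelian (its second derived ideal is `0`). -/
noncomputable def relF : LieIdeal (ZMod p) (FreeL p) :=
  idealSpan (ZMod p) {x : FreeL p | ∃ i j : ℕ,
      x = ⁅FreeLieAlgebra.of (ZMod p) (Gen.c i), FreeLieAlgebra.of (ZMod p) (Gen.c j)⁆} ⊔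
  (⨆ i : ℕ,
    ⁅idealSpan (ZMod p) {FreeLieAlgebra.of (ZMod p) (Gen.c i)},
      idealSpan (ZMod p) {FreeLieAlgebra.of (ZMod p) (Gen.c i)}⁆) ⊔
  LieAlgebra.derivedSeriesOfIdeal (ZMod p) (FreeL p) 2
    (idealSpan (ZMod p) {FreeLieAlgebra.of (ZMod p) Gen.z})

/-- The largest Lie algebra `F` over `𝔽_p` generated by `z` and commuting `c₁, c₂, …` in which
every `Id(c_i)` is abelian and `Id(z)` is metabelian. -/
abbrev F : Type := FreeL p ⧸ relF p

/-- The image in `F` of a generator. -/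
noncomputable def genF (g : Gen) : F p := LieSubmodule.Quotient.mk (FreeLieAlgebra.of (ZMod p) g)

/-- `[z, c_I]`: the left-normed commutator `[z, c_{i₁}, …, c_{iₖ}]`, where
`I = {i₁ < ⋯ < iₖ}`. -/
noncomputable def zc (I : Finset ℕ) : F p :=
  (I.sort (· ≤ ·)).foldl (fun u i => ⁅u, genF p (Gen.c i)⁆) (genF p Gen.z)

/-- The left-normed commutator `[[z, c_{I₁}], [z, c_{I₂}], …, [z, c_{Iₘ}]]` of a list
`I₁, …, Iₘ` (with the junk value `0` for the empty list). -/
noncomputable def leftNormed : List (Finset ℕ) → F p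
  | [] => 0
  | I₁ :: Is => Is.foldl (fun u I => ⁅u, zc p I⁆) (zc p I₁)

end AlgebraF

/-- The strict order on the elements `[z, c_I]`: for nonempty index sets compare the words
`z c_{i₁} ⋯ c_{iₖ}` lexicographically, and let `z` itself (`I = ∅`) be the largest element. -/
def ltZ (I J : Finset ℕ) : Prop :=
  I.Nonempty ∧ (J = ∅ ∨ I.sort (· ≤ ·) < J.sort (· ≤ ·))

/-- The corresponding non-strict order. -/
def leZ (I J : Finset ℕ) : Prop := ltZ I J ∨ I = J

/-- The lists `I₁, …, Iₘ` (`m ≥ 1`) that index basis commutators: pairwise disjoint, with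
`[z, c_{I₁}] > [z, c_{I₂}] ≤ [z, c_{I₃}] ≤ ⋯ ≤ [z, c_{Iₘ}]`. -/
def IsBasic : List (Finset ℕ) → Prop
  | [] => False
  | [_] => True
  | I₁ :: I₂ :: Is =>
    (I₁ :: I₂ :: Is).Pairwise Disjoint ∧ ltZ I₂ I₁ ∧ (I₂ :: Is).IsChain leZ

/-- The type `e₁ + e₂ + ⋯ - 2m` of the commutator indexed by `I₁, …, Iₘ`. -/
def commType (l : List (Finset ℕ)) : ℤ :=
  ((l.map Finset.card).sum : ℤ) - 2 * (l.length : ℤ)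

/-- The basis commutator is different from `z`, and its type is less than `-1` or more
than `1`. -/
def BadType (l : List (Finset ℕ)) : Prop :=
  l ≠ [∅] ∧ (commType l < -1 ∨ 1 < commType l)

/-- The basis commutator is a proper one (`m ≥ 2`), and one of `I₁, I₃, …, Iₘ` (every position
but the second, which has index `1` here) has more than two elements. -/
def BadSize (l : List (Finset ℕ)) : Prop :=
  2 ≤ l.length ∧ ∃ (k : ℕ) (hk : k < l.length), k ≠ 1 ∧ 2 < (l[k]).card

section AlgebraL

variable (p : ℕ)

/-- The ideal `J` of `F`. -/
noncomputable def J : LieIdeal (ZMod p) (F p) :=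
  idealSpan (ZMod p) {x : F p | ∃ l : List (Finset ℕ),
    IsBasic l ∧ (BadType l ∨ BadSize l) ∧ x = leftNormed p l}

/-- The Lie algebra `L = F / J`. -/
abbrev L : Type := F p ⧸ J p

/-- The image of `z` in `L`. -/
noncomputable def zL : L p := LieSubmodule.Quotient.mk (genF p Gen.z)

end AlgebraL

end EngelLie

namespace EngelLie

-- The proof maps `L` to 5×5 matrices over a Grassmann algebra and finds arbitrarily long nonzero
-- commutators in the image of the ideal of `z`.
--
-- The first four coordinates e₀, …, e₃ are the exterior algebra of a plane: the two matrices `matD`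
-- are multiplication by e₁ and by e₂, `matZ` sends the top vector e₃ = e₁∧e₂ to the unit e₀, and
-- the commutators `matX` of `matZ` with `matD` are contractions up to sign. The generator `c 0`
-- sends an extra vector e₄ to e₃; every other `c i` is a `matD`, chosen by parity, times its own
-- odd variable `xi i`. Odd scalars turn commutators into anticommutators, so these `c i` commute,
-- while `[z, c i, c j]` is `xi i * xi j` times 0 or ±`matP`. As `matP` is the identity on the first
-- four coordinates, a third `c k` with `k ≠ 0` kills it (`lie_genModel_z_c_c_c`).
--
-- The image of the ideal of `z` lies in `core`, whose brackets fall into the abelian space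
-- `lastColumn` (`core_lie_core`); hence metabelianity. Giving `z` degree -2 and each `c i` degree 1
-- makes type a degree, and the last column lives only in degrees -1, 0, 1, which kills commutators
-- of bad type. Since 0 is the least index, a set containing it must stand second in a proper basis
-- commutator, so every other factor with more than two elements vanishes.
--
-- Finally `[z, c 0]` is the matrix unit from e₄ to e₀, and each `[z, c (2k+1), c (2k+2)]`
-- multiplies it, up to sign, by two new Grassmann variables. The resulting products of distinct
-- variables never vanish (`xi_prod_ne_zero`).

attribute [local instance] LieRing.ofAssociativeRing

/-! ### Homomorphisms out of quotients, and images of generated ideals -/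

section Lift

variable {R A B : Type*} [CommRing R] [LieRing A] [LieAlgebra R A] [LieRing B] [LieAlgebra R B]

/-- A homomorphism of Lie algebras that vanishes on an ideal factors through the quotient. -/
noncomputable def quotLift (I : LieIdeal R A) (f : A →ₗ⁅R⁆ B) (h : ∀ x ∈ I, f x = 0) :
    A ⧸ I →ₗ⁅R⁆ B :=
  { Submodule.liftQ I.toSubmodule (f : A →ₗ[R] B) (fun x hx => h x hx) with
    map_lie' := by
      intro x y
      induction x using Submodule.Quotient.induction_on
      induction y using Submodule.Quotient.induction_on
      exact f.map_lie _ _ }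

theorem map_eq_zero_of_mem_lieSpan (f : A →ₗ⁅R⁆ B) {s : Set A} (hs : ∀ x ∈ s, f x = 0) {x : A}
    (hx : x ∈ idealSpan R s) : f x = 0 := by
  have : idealSpan R s ≤ f.ker := LieSubmodule.lieSpan_le.mpr fun y hy => (hs y hy)
  exact this hx

/-- A property of elements that defines a subalgebra holds on the image of a free Lie algebra as
soon as it holds on the images of the generators. -/
theorem freeLie_map_mem {X : Type*} (f : FreeLieAlgebra R X →ₗ⁅R⁆ B) (K : LieSubalgebra R B)
    (h : ∀ g, f (FreeLieAlgebra.of R g) ∈ K) (x : FreeLieAlgebra R X) : f x ∈ K := by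
  have : f = K.incl.comp (FreeLieAlgebra.lift R fun g => (⟨_, h g⟩ : K)) := by
    ext g
    simp
  rw [this]
  exact SetLike.coe_mem _

/-- The elements whose adjoint action preserves a submodule. -/
def stabilizer (W : Submodule R B) : LieSubalgebra R B where
  carrier := {a | ∀ m ∈ W, ⁅a, m⁆ ∈ W}
  add_mem' ha hb m hm := by
    rw [add_lie]
    exact W.add_mem (ha m hm) (hb m hm)
  zero_mem' m _ := by simp
  smul_mem' r a ha m hm := by
    rw [smul_lie]
    exact W.smul_mem r (ha m hm)
  lie_mem' ha hb m hm := by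
    rw [lie_lie]
    exact W.sub_mem (ha _ (hb m hm)) (hb _ (ha m hm))

/-- The preimage of a submodule that is preserved by the image. -/
noncomputable def preimageIdeal (f : A →ₗ⁅R⁆ B) (W : Submodule R B) (h : ∀ x, f x ∈ stabilizer W) :
    LieIdeal R A where
  toSubmodule := W.comap (f : A →ₗ[R] B)
  lie_mem {x m} hm := by
    change f ⁅x, m⁆ ∈ W
    rw [f.map_lie]
    exact h x _ hm

theorem mem_preimageIdeal {f : A →ₗ⁅R⁆ B} {W : Submodule R B} {h : ∀ x, f x ∈ stabilizer W}
    {x : A} : x ∈ preimageIdeal f W h ↔ f x ∈ W := Iff.rfl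

theorem map_idealSpan_mem (f : A →ₗ⁅R⁆ B) (W : Submodule R B) (h : ∀ x, f x ∈ stabilizer W)
    {s : Set A} (hs : ∀ x ∈ s, f x ∈ W) {x : A} (hx : x ∈ idealSpan R s) : f x ∈ W := by
  have : idealSpan R s ≤ preimageIdeal f W h :=
    LieSubmodule.lieSpan_le.mpr fun y hy => mem_preimageIdeal.mpr (hs y hy)
  exact this hx

theorem map_lie_ideal_mem (f : A →ₗ⁅R⁆ B) (W : Submodule R B) (h : ∀ x, f x ∈ stabilizer W)
    {I K : LieIdeal R A} (hIK : ∀ x ∈ I, ∀ y ∈ K, ⁅f x, f y⁆ ∈ W) {x : A} (hx : x ∈ ⁅I, K⁆) :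
    f x ∈ W := by
  have : ⁅I, K⁆ ≤ preimageIdeal f W h := by
    rw [LieSubmodule.lie_le_iff]
    intro a ha b hb
    rw [mem_preimageIdeal, f.map_lie]
    exact hIK a ha b hb
  exact this hx

end Lift

/-! ### The Grassmann algebra -/

section Grassmann

variable (R : Type*) [CommRing R]

/-- The exterior algebra on countably many generators. -/
abbrev Grass : Type _ := ExteriorAlgebra R (ℕ →₀ R)

variable {R}

/-- The generators of the exterior algebra. -/
noncomputable def xi (i : ℕ) : Grass R := ExteriorAlgebra.ι R (Finsupp.single i 1)

theorem ι_mul_ι_comm (u v : ℕ →₀ R) :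
    ExteriorAlgebra.ι R u * ExteriorAlgebra.ι R v
      = -(ExteriorAlgebra.ι R v * ExteriorAlgebra.ι R u) :=
  eq_neg_of_add_eq_zero_left (ExteriorAlgebra.ι_add_mul_swap u v)

/-- Moving a generator past two generators costs two signs, which cancel. -/
theorem ι_mul_ι_mem_center (u v : ℕ →₀ R) :
    ExteriorAlgebra.ι R u * ExteriorAlgebra.ι R v ∈ Subalgebra.center R (Grass R) := by
  rw [Subalgebra.mem_center_iff]
  intro b
  induction b using ExteriorAlgebra.induction with
  | algebraMap r => exact Algebra.commutes r _
  | ι w =>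
    rw [← mul_assoc, ι_mul_ι_comm w u, neg_mul, mul_assoc, ι_mul_ι_comm w v, mul_neg, neg_neg,
      mul_assoc]
  | mul a b ha hb => rw [mul_assoc, hb, ← mul_assoc, ha, mul_assoc]
  | add a b ha hb => rw [add_mul, mul_add, ha, hb]

/-- Lets a generator be pulled to the front of any product, so that its left multiples form a
two-sided ideal. -/
theorem exists_mul_ι_eq (a : Grass R) (u : ℕ →₀ R) :
    ∃ b, a * ExteriorAlgebra.ι R u = ExteriorAlgebra.ι R u * b := by
  induction a using ExteriorAlgebra.induction with
  | algebraMap r => exact ⟨_, Algebra.commutes r _⟩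
  | ι w => exact ⟨-ExteriorAlgebra.ι R w, by rw [ι_mul_ι_comm w u, mul_neg]⟩
  | mul a b ha hb =>
    obtain ⟨a', ha⟩ := ha
    obtain ⟨b', hb⟩ := hb
    exact ⟨a' * b', by rw [mul_assoc, hb, ← mul_assoc, ha, mul_assoc]⟩
  | add a b ha hb =>
    obtain ⟨a', ha⟩ := ha
    obtain ⟨b', hb⟩ := hb
    exact ⟨a' + b', by rw [add_mul, mul_add, ha, hb]⟩

theorem xi_mul_mul_xi (i : ℕ) (a : Grass R) : xi i * a * xi i = 0 := by
  obtain ⟨b, hb⟩ := exists_mul_ι_eq a (Finsupp.single i 1)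
  rw [mul_assoc, xi, hb, ← mul_assoc, ExteriorAlgebra.ι_sq_zero, zero_mul]

open CliffordAlgebra in
theorem contractLeft_xi_prod_of_notMem (i : ℕ) (l : List ℕ) (h : i ∉ l) :
    contractLeft (Finsupp.lapply i : (ℕ →₀ R) →ₗ[R] R) ((l.map (xi (R := R))).prod) = 0 := by
  induction l with
  | nil => exact contractLeft_one _ _
  | cons j l ih =>
    rw [List.mem_cons, not_or] at h
    rw [List.map_cons, List.prod_cons, xi, ExteriorAlgebra.ι, contractLeft_ι_mul, ih h.2]
    simp [Ne.symm h.1]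

open CliffordAlgebra in
-- Contraction with the coordinate dual to the first variable strips that variable and annihilates
-- the remaining product, so a vanishing product would force a shorter one to vanish.
theorem xi_prod_ne_zero [Nontrivial R] (l : List ℕ) (h : l.Nodup) :
    (l.map (xi (R := R))).prod ≠ 0 := by
  induction l with
  | nil => exact one_ne_zero
  | cons j l ih =>
    rw [List.nodup_cons] at h
    intro h0
    apply ih h.2
    have := congrArg (contractLeft (Finsupp.lapply j : (ℕ →₀ R) →ₗ[R] R)) h0
    rw [List.map_cons, List.prod_cons, xi, ExteriorAlgebra.ι, contractLeft_ι_mul,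
      contractLeft_xi_prod_of_notMem j l h.1] at this
    simpa using this

end Grassmann

/-! ### The matrix model -/

section Model

variable (R : Type*) [CommRing R]

/-- The associative algebra that contains the model. -/
abbrev Model : Type _ := Matrix (Fin 5) (Fin 5) (Grass R)

variable {R}

/-- An integral matrix multiplied by an element of the exterior algebra. -/
noncomputable def scaled (a : Grass R) (M : Matrix (Fin 5) (Fin 5) ℤ) : Model R :=
  Matrix.of fun i j => a * (M i j : Grass R)

theorem scaled_apply (a : Grass R) (M : Matrix (Fin 5) (Fin 5) ℤ) (i j : Fin 5) :
    scaled a M i j = a * (M i j : Grass R) := rfl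

theorem scaled_mul (a b : Grass R) (M N : Matrix (Fin 5) (Fin 5) ℤ) :
    scaled a M * scaled b N = scaled (a * b) (M * N) := by
  ext i j
  simp only [Matrix.mul_apply, scaled_apply, Int.cast_sum, Int.cast_mul, Finset.mul_sum]
  refine Finset.sum_congr rfl fun k _ => ?_
  rw [mul_assoc, ← mul_assoc (M i k : Grass R), Int.cast_comm, mul_assoc, mul_assoc]

theorem lie_scaled_of_comm {a b : Grass R} (h : b * a = a * b)
    (M N : Matrix (Fin 5) (Fin 5) ℤ) :
    ⁅scaled a M, scaled b N⁆ = scaled (a * b) (M * N - N * M) := by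
  rw [Ring.lie_def, scaled_mul, scaled_mul, h]
  ext i j
  simp [scaled_apply, mul_sub]

theorem lie_scaled_of_anticomm {a b : Grass R} (h : b * a = -(a * b))
    (M N : Matrix (Fin 5) (Fin 5) ℤ) :
    ⁅scaled a M, scaled b N⁆ = scaled (a * b) (M * N + N * M) := by
  rw [Ring.lie_def, scaled_mul, scaled_mul, h]
  ext i j
  simp [scaled_apply, mul_add]

@[simp]
theorem scaled_zero (a : Grass R) : scaled a 0 = 0 := by
  ext i j
  simp [scaled_apply]

theorem scaled_neg (a : Grass R) (M : Matrix (Fin 5) (Fin 5) ℤ) :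
    scaled a (-M) = scaled (-a) M := by
  ext i j
  simp [scaled_apply]

/-- The matrix of `z`. -/
def matZ : Matrix (Fin 5) (Fin 5) ℤ :=
  !![0,0,0,1,0; 0,0,0,0,0; 0,0,0,0,0; 0,0,0,0,0; 0,0,0,0,0]

/-- The matrix of the first of the `c_i`. -/
def matC : Matrix (Fin 5) (Fin 5) ℤ :=
  !![0,0,0,0,0; 0,0,0,0,0; 0,0,0,0,0; 0,0,0,0,1; 0,0,0,0,0]

/-- The matrices of the other `c_i`, according to the parity of the index. -/
def matD : Bool → Matrix (Fin 5) (Fin 5) ℤ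
  | false => !![0,0,0,0,0; 1,0,0,0,0; 0,0,0,0,0; 0,0,1,0,0; 0,0,0,0,0]
  | true => !![0,0,0,0,0; 0,0,0,0,0; 1,0,0,0,0; 0,-1,0,0,0; 0,0,0,0,0]

/-- The commutators of `matZ` with the matrices `matD`. -/
def matX : Bool → Matrix (Fin 5) (Fin 5) ℤ
  | false => !![0,0,1,0,0; 0,0,0,-1,0; 0,0,0,0,0; 0,0,0,0,0; 0,0,0,0,0]
  | true => !![0,-1,0,0,0; 0,0,0,0,0; 0,0,0,-1,0; 0,0,0,0,0; 0,0,0,0,0]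

/-- The projection onto the first four coordinates. -/
def matP : Matrix (Fin 5) (Fin 5) ℤ :=
  !![1,0,0,0,0; 0,1,0,0,0; 0,0,1,0,0; 0,0,0,1,0; 0,0,0,0,0]

/-- The scalar by which a double commutator acts. -/
def pairing : Bool → Bool → ℤ
  | false, true => 1
  | true, false => -1
  | _, _ => 0

theorem matZ_lie_matD (s : Bool) : matZ * matD s - matD s * matZ = matX s := by
  cases s <;> decide

/-- The canonical anticommutation relations between contractions and exterior multiplications on the
first four coordinates. -/
theorem matX_anti_matD (s t : Bool) :
    matX s * matD t + matD t * matX s = pairing s t • matP := by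
  cases s <;> cases t <;> decide

theorem matX_anti_matX (s t : Bool) : matX s * matX t + matX t * matX s = 0 := by
  cases s <;> cases t <;> decide

theorem matZ_lie_matX (s : Bool) : matZ * matX s - matX s * matZ = 0 := by
  cases s <;> decide

theorem matZ_lie_matP : matZ * matP - matP * matZ = 0 := by decide

theorem matP_lie_matX (s : Bool) : matP * matX s - matX s * matP = 0 := by
  cases s <;> decide

theorem matP_lie_matD (s : Bool) : matP * matD s - matD s * matP = 0 := by
  cases s <;> decide

theorem matD_anti_matD (s t : Bool) : matD s * matD t + matD t * matD s = 0 := by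
  cases s <;> cases t <;> decide

theorem matC_lie_matD (s : Bool) : matC * matD s - matD s * matC = 0 := by
  cases s <;> decide

/-- The images of the generators in the model. -/
noncomputable def genModel : Gen → Model R
  | Gen.z => scaled 1 matZ
  | Gen.c 0 => scaled 1 matC
  | Gen.c (i + 1) => scaled (xi (i + 1)) (matD (i + 1).bodd)

/-! ### The abelian space of last-column matrices -/

/-- The matrices supported in the last column, above the diagonal. -/
def lastColumn (R : Type*) [CommRing R] : Submodule R (Model R) where
  carrier := {M | (∀ i j, j ≠ 4 → M i j = 0) ∧ M 4 4 = 0}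
  add_mem' hM hN := ⟨fun i j h => by simp [hM.1 i j h, hN.1 i j h], by simp [hM.2, hN.2]⟩
  zero_mem' := by simp
  smul_mem' r M hM := ⟨fun i j h => by simp [hM.1 i j h], by simp [hM.2]⟩

/-- The matrices with vanishing last row. -/
def lastRowZero (R : Type*) [CommRing R] : LieSubalgebra R (Model R) where
  carrier := {M | ∀ j, M 4 j = 0}
  add_mem' hM hN j := by simp [hM j, hN j]
  zero_mem' := by simp
  smul_mem' r M hM j := by simp [hM j]
  lie_mem' {M N} hM hN j := by
    simp [Ring.lie_def, Matrix.mul_apply, hM _, hN _]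

/-- In block form 4+1, `A` has zero bottom row and `M` has only the upper right block; then `M * A =
0` and `A * M` has the shape of `M`. -/
theorem lie_mem_lastColumn {A M : Model R} (hA : A ∈ lastRowZero R) (hM : M ∈ lastColumn R) :
    ⁅A, M⁆ ∈ lastColumn R := by
  have hA' : ∀ j, A 4 j = 0 := hA
  obtain ⟨h1, h2⟩ := hM
  have hM4 : ∀ j, M 4 j = 0 := fun j => by
    by_cases h : j = 4
    · rw [h, h2]
    · exact h1 _ _ h
  refine ⟨fun i j hj => ?_, ?_⟩
  · rw [Ring.lie_def, Matrix.sub_apply, Matrix.mul_apply, Matrix.mul_apply,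
      Finset.sum_eq_zero fun k _ => by rw [h1 k j hj, mul_zero], Finset.sum_eq_zero, sub_zero]
    intro k _
    by_cases h : k = 4
    · rw [h, hA', mul_zero]
    · rw [h1 i k h, zero_mul]
  · simp [Ring.lie_def, Matrix.mul_apply, hA', hM4]

theorem lie_lastColumn {M N : Model R} (hM : M ∈ lastColumn R) (hN : N ∈ lastColumn R) :
    ⁅M, N⁆ = 0 := by
  have key : ∀ {M N : Model R}, M ∈ lastColumn R → N ∈ lastColumn R → M * N = 0 := by
    intro M N hM hN
    ext i j
    rw [Matrix.mul_apply, Matrix.zero_apply]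
    refine Finset.sum_eq_zero fun k _ => ?_
    by_cases h : k = 4
    · subst h
      by_cases hj : j = 4
      · rw [hj, hN.2, mul_zero]
      · rw [hN.1 _ _ hj, mul_zero]
    · rw [hM.1 _ _ h, zero_mul]
  rw [Ring.lie_def, key hM hN, key hN hM, sub_zero]

theorem scaled_matC_mem_lastColumn (a : Grass R) : scaled a matC ∈ lastColumn R := by
  refine ⟨fun i j h => ?_, by simp [scaled_apply, matC]⟩
  have : ∀ i j : Fin 5, j ≠ 4 → matC i j = 0 := by
    intro i j
    fin_cases i <;> fin_cases j <;> decide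
  rw [scaled_apply, this i j h, Int.cast_zero, mul_zero]

theorem scaled_mem_lastRowZero (a : Grass R) {M : Matrix (Fin 5) (Fin 5) ℤ}
    (h : ∀ j, M 4 j = 0) : scaled a M ∈ lastRowZero R := fun j => by
  rw [scaled_apply, h, Int.cast_zero, mul_zero]

theorem genModel_mem_lastRowZero (g : Gen) : genModel g ∈ lastRowZero R := by
  match g with
  | Gen.z => exact scaled_mem_lastRowZero _ (by decide)
  | Gen.c 0 => exact scaled_mem_lastRowZero _ (by decide)
  | Gen.c (i + 1) =>
    have : ∀ s, ∀ j, matD s 4 j = 0 := by decide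
    exact scaled_mem_lastRowZero _ (this _)

theorem lastColumn_le_lastRowZero {M : Model R} (hM : M ∈ lastColumn R) : M ∈ lastRowZero R := by
  intro j
  by_cases h : j = 4
  · rw [h, hM.2]
  · exact hM.1 _ _ h

/-! ### The image of the ideal of z, and the defining relations -/

/-- A spanning set of a subspace that contains the image of the ideal generated by `z`. -/
def coreSet (R : Type*) [CommRing R] : Set (Model R) :=
  {M | M = scaled 1 matZ ∨ (∃ u s, M = scaled (ExteriorAlgebra.ι R u) (matX s)) ∨
    (∃ d ∈ Subalgebra.center R (Grass R), M = scaled d matP) ∨ M ∈ lastColumn R}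

theorem coreSet_subset_lastRowZero {M : Model R} (hM : M ∈ coreSet R) : M ∈ lastRowZero R := by
  have hX : ∀ s, ∀ j, matX s 4 j = 0 := by decide
  rcases hM with rfl | ⟨u, s, rfl⟩ | ⟨d, -, rfl⟩ | h
  · exact scaled_mem_lastRowZero _ (by decide)
  · exact scaled_mem_lastRowZero _ (hX s)
  · exact scaled_mem_lastRowZero _ (by decide)
  · exact lastColumn_le_lastRowZero h

theorem lie_mem_lastColumn' {A M : Model R} (hA : A ∈ lastRowZero R) (hM : M ∈ lastColumn R) :
    ⁅M, A⁆ ∈ lastColumn R := by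
  rw [← lie_skew]
  exact neg_mem (lie_mem_lastColumn hA hM)

/-- Outside the last column all these matrices commute: contractions anticommute and carry odd
scalars, `matZ` commutes with contractions, and `matP` is the identity of the 4×4 block. This gives
metabelianity and puts every proper basis commutator into the last column. -/
theorem coreSet_lie_coreSet {M N : Model R} (hM : M ∈ coreSet R) (hN : N ∈ coreSet R) :
    ⁅M, N⁆ ∈ lastColumn R := by
  have hM' := coreSet_subset_lastRowZero hM
  have hN' := coreSet_subset_lastRowZero hN
  have hZ0 : ∀ {M N : Model R}, ⁅M, N⁆ = 0 → ⁅N, M⁆ ∈ lastColumn R := by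
    intro M N h
    rw [← lie_skew, h, neg_zero]
    exact zero_mem _
  have hZ1 : ∀ {M N : Model R}, ⁅M, N⁆ = 0 → ⁅M, N⁆ ∈ lastColumn R := by
    intro M N h
    rw [h]
    exact zero_mem _
  have hZX : ∀ u s, ⁅scaled (1 : Grass R) matZ, scaled (ExteriorAlgebra.ι R u) (matX s)⁆ = 0 := by
    intro u s
    rw [lie_scaled_of_comm (by simp), matZ_lie_matX, scaled_zero]
  have hZP : ∀ d : Grass R, ⁅scaled (1 : Grass R) matZ, scaled d matP⁆ = 0 := by
    intro d
    rw [lie_scaled_of_comm (by simp), matZ_lie_matP, scaled_zero]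
  have hPX : ∀ d ∈ Subalgebra.center R (Grass R), ∀ u s,
      ⁅scaled d matP, scaled (ExteriorAlgebra.ι R u) (matX s)⁆ = 0 := by
    intro d hd u s
    rw [lie_scaled_of_comm (Subalgebra.mem_center_iff.mp hd _), matP_lie_matX, scaled_zero]
  rcases hM with rfl | ⟨u, s, rfl⟩ | ⟨d, hd, rfl⟩ | hM
  · rcases hN with rfl | ⟨v, t, rfl⟩ | ⟨e, he, rfl⟩ | hN
    · exact hZ1 (lie_self _)
    · exact hZ1 (hZX _ _)
    · exact hZ1 (hZP _)
    · exact lie_mem_lastColumn hM' hN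
  · rcases hN with rfl | ⟨v, t, rfl⟩ | ⟨e, he, rfl⟩ | hN
    · exact hZ0 (hZX _ _)
    · apply hZ1
      rw [lie_scaled_of_anticomm (ι_mul_ι_comm _ _), matX_anti_matX, scaled_zero]
    · exact hZ0 (hPX e he _ _)
    · exact lie_mem_lastColumn hM' hN
  · rcases hN with rfl | ⟨v, t, rfl⟩ | ⟨e, he, rfl⟩ | hN
    · exact hZ0 (hZP _)
    · exact hZ1 (hPX d hd _ _)
    · apply hZ1
      rw [lie_scaled_of_comm (Subalgebra.mem_center_iff.mp hd _), sub_self, scaled_zero]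
    · exact lie_mem_lastColumn hM' hN
  · exact lie_mem_lastColumn' hN' hM

theorem scaled_smul_matP_mem (d : Grass R) (hd : d ∈ Subalgebra.center R (Grass R)) (n : ℤ) :
    ∃ e ∈ Subalgebra.center R (Grass R), scaled d (n • matP) = scaled e matP := by
  refine ⟨n • d, zsmul_mem hd n, ?_⟩
  ext i j
  rw [scaled_apply, scaled_apply, Matrix.smul_apply, smul_eq_mul, Int.cast_mul, zsmul_eq_mul,
    ← mul_assoc, Int.cast_comm]

/-- Bracketing with a `c i`, `i ≠ 0`, moves along the chain `matZ`, `matX`, `matP`, 0; bracketing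
with `z` or `c 0` lands in the last column. -/
theorem genModel_lie_coreSet (g : Gen) {M : Model R} (hM : M ∈ coreSet R) :
    ⁅genModel (R := R) g, M⁆ ∈ coreSet R := by
  match g with
  | Gen.z => exact Or.inr (Or.inr (Or.inr (coreSet_lie_coreSet (Or.inl rfl) hM)))
  | Gen.c 0 =>
    exact Or.inr (Or.inr (Or.inr
      (lie_mem_lastColumn' (coreSet_subset_lastRowZero hM) (scaled_matC_mem_lastColumn _))))
  | Gen.c (i + 1) =>
    rcases hM with rfl | ⟨u, s, rfl⟩ | ⟨d, hd, rfl⟩ | hM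
    -- The sign of `[c, z] = -[z, c]` is absorbed into the vector.
    · refine Or.inr (Or.inl ⟨-Finsupp.single (i + 1) 1, (i + 1).bodd, ?_⟩)
      rw [genModel, ← lie_skew, lie_scaled_of_comm (by simp), matZ_lie_matD, one_mul, map_neg,
        ← scaled_neg]
      ext i j
      simp [scaled_apply, xi]
    · refine Or.inr (Or.inr (Or.inl ?_))
      rw [genModel, xi, lie_scaled_of_anticomm (ι_mul_ι_comm _ _), add_comm (matD _ * _),
        matX_anti_matD]
      exact scaled_smul_matP_mem _ (ι_mul_ι_mem_center _ _) _
    · refine Or.inr (Or.inr (Or.inr ?_))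
      rw [genModel, ← lie_skew, lie_scaled_of_comm (Subalgebra.mem_center_iff.mp hd _),
        matP_lie_matD, scaled_zero, neg_zero]
      exact zero_mem _
    · exact Or.inr (Or.inr (Or.inr (lie_mem_lastColumn (genModel_mem_lastRowZero _) hM)))

theorem genModel_c_lie_genModel_c (i j : ℕ) :
    ⁅genModel (R := R) (Gen.c i), genModel (R := R) (Gen.c j)⁆ = 0 := by
  match i, j with
  | 0, 0 => exact lie_self _
  | 0, j + 1 => rw [genModel, genModel, lie_scaled_of_comm (by simp), matC_lie_matD, scaled_zero]
  | i + 1, 0 =>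
    rw [genModel, genModel, ← lie_skew, lie_scaled_of_comm (by simp), matC_lie_matD, scaled_zero,
      neg_zero]
  | i + 1, j + 1 =>
    rw [genModel, genModel, xi, xi, lie_scaled_of_anticomm (ι_mul_ι_comm _ _), matD_anti_matD,
      scaled_zero]

/-- The matrices with entries in the ideal generated by `xi i`. -/
noncomputable def xiMultiples (R : Type*) [CommRing R] (i : ℕ) : Submodule R (Model R) where
  carrier := {M | ∀ k l, ∃ a, M k l = xi i * a}
  add_mem' hM hN k l := by
    obtain ⟨a, ha⟩ := hM k l
    obtain ⟨b, hb⟩ := hN k l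
    exact ⟨a + b, by rw [Matrix.add_apply, ha, hb, mul_add]⟩
  zero_mem' k l := ⟨0, by simp⟩
  smul_mem' r M hM k l := by
    obtain ⟨a, ha⟩ := hM k l
    exact ⟨r • a, by rw [Matrix.smul_apply, ha, mul_smul_comm]⟩

theorem lie_mem_xiMultiples (i : ℕ) (A : Model R) {M : Model R} (hM : M ∈ xiMultiples R i) :
    ⁅A, M⁆ ∈ xiMultiples R i := by
  intro k l
  choose a ha using hM
  choose b hb using fun c : Grass R => exists_mul_ι_eq c (Finsupp.single i 1)
  -- In `A * M` the variable must first be moved left past the entry of `A`, which turns that entry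
  -- into its `b`; in `M * A` it already stands in front.
  refine ⟨∑ j, b (A k j) * a j l - ∑ j, a k j * A j l, ?_⟩
  simp only [Ring.lie_def, Matrix.sub_apply, Matrix.mul_apply, ha, mul_sub, Finset.mul_sum, xi,
    ← mul_assoc, hb]

/-- Every term of either product contains `xi i` twice. This makes the ideal of `c i` abelian for `i
≠ 0`. -/
theorem lie_xiMultiples (i : ℕ) {M N : Model R} (hM : M ∈ xiMultiples R i)
    (hN : N ∈ xiMultiples R i) : ⁅M, N⁆ = 0 := by
  choose a ha using hM
  choose b hb using hN
  ext k l
  simp [Ring.lie_def, Matrix.mul_apply, ha, hb, ← mul_assoc, xi_mul_mul_xi]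

/-! ### The grading that realizes the type -/

/-- The degrees of the coordinates. -/
def coordDeg : Fin 5 → ℤ := ![-2, -1, -1, 0, -1]

/-- The matrices that are homogeneous of degree `t`. -/
def IsHomog (t : ℤ) (M : Model R) : Prop := ∀ i j, coordDeg i - coordDeg j ≠ t → M i j = 0

theorem IsHomog.mul {s t : ℤ} {M N : Model R} (hM : IsHomog s M) (hN : IsHomog t N) :
    IsHomog (s + t) (M * N) := by
  intro i j h
  rw [Matrix.mul_apply]
  refine Finset.sum_eq_zero fun k _ => ?_
  by_cases h1 : coordDeg i - coordDeg k = s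
  · rw [hN k j (by omega), mul_zero]
  · rw [hM i k h1, zero_mul]

theorem IsHomog.lie {s t : ℤ} {M N : Model R} (hM : IsHomog s M) (hN : IsHomog t N) :
    IsHomog (s + t) ⁅M, N⁆ := by
  intro i j h
  rw [Ring.lie_def, Matrix.sub_apply, hM.mul hN i j h, hN.mul hM i j (by omega), sub_zero]

theorem IsHomog.scaled {t : ℤ} (a : Grass R) {M : Matrix (Fin 5) (Fin 5) ℤ}
    (h : ∀ i j, coordDeg i - coordDeg j ≠ t → M i j = 0) : IsHomog t (scaled a M) := by
  intro i j hij
  rw [scaled_apply, h i j hij, Int.cast_zero, mul_zero]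

theorem isHomog_genModel_z : IsHomog (-2) (genModel (R := R) Gen.z) :=
  IsHomog.scaled _ (by intro i j; fin_cases i <;> fin_cases j <;> decide)

theorem isHomog_genModel_c (i : ℕ) : IsHomog 1 (genModel (R := R) (Gen.c i)) := by
  match i with
  | 0 => exact IsHomog.scaled _ (by intro i j; fin_cases i <;> fin_cases j <;> decide)
  | i + 1 =>
    have : ∀ s, ∀ i j, coordDeg i - coordDeg j ≠ 1 → matD s i j = 0 := by
      intro s i j
      cases s <;> fin_cases i <;> fin_cases j <;> decide
    exact IsHomog.scaled _ (this _)

/-- The last coordinate has degree -1 and all coordinates have degrees from -2 to 0, so last-column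
entries have degrees from -1 to 1 only. -/
theorem IsHomog.eq_zero_of_mem_lastColumn {t : ℤ} {M : Model R} (hM : IsHomog t M)
    (h : M ∈ lastColumn R) (ht : t < -1 ∨ 1 < t) : M = 0 := by
  have hd : ∀ i, -1 ≤ coordDeg i - coordDeg 4 ∧ coordDeg i - coordDeg 4 ≤ 1 := by decide
  ext i j
  by_cases hj : j = 4
  · subst hj
    have := hd i
    exact hM i 4 (by omega)
  · exact h.1 i j hj

end Model

/-! ### Passing from the spanning set to its span -/

section Core

variable {R : Type*} [CommRing R]

/-- The subspace spanned by `coreSet`. -/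
noncomputable def core (R : Type*) [CommRing R] : Submodule R (Model R) := Submodule.span R (coreSet R)

theorem lie_mem_core (g : Gen) {M : Model R} (hM : M ∈ core R) :
    ⁅genModel (R := R) g, M⁆ ∈ core R := by
  induction hM using Submodule.span_induction with
  | mem M h => exact Submodule.subset_span (genModel_lie_coreSet g h)
  | zero => rw [lie_zero]; exact zero_mem _
  | add M N _ _ hM hN => rw [lie_add]; exact add_mem hM hN
  | smul r M _ hM => rw [lie_smul]; exact Submodule.smul_mem _ r hM

theorem core_lie_core {M N : Model R} (hM : M ∈ core R) (hN : N ∈ core R) :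
    ⁅M, N⁆ ∈ lastColumn R := by
  induction hM using Submodule.span_induction with
  | mem M hM =>
    induction hN using Submodule.span_induction with
    | mem N hN => exact coreSet_lie_coreSet hM hN
    | zero => rw [lie_zero]; exact zero_mem _
    | add N N' _ _ h h' => rw [lie_add]; exact add_mem h h'
    | smul r N _ h => rw [lie_smul]; exact Submodule.smul_mem _ r h
  | zero => rw [zero_lie]; exact zero_mem _
  | add M M' _ _ h h' => rw [add_lie]; exact add_mem h h'
  | smul r M _ h => rw [smul_lie]; exact Submodule.smul_mem _ r h

theorem core_le_lastRowZero {M : Model R} (hM : M ∈ core R) : M ∈ lastRowZero R := by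
  have : core R ≤ (lastRowZero R).toSubmodule :=
    Submodule.span_le.mpr fun N hN => coreSet_subset_lastRowZero hN
  exact this hM

theorem genModel_z_mem_core : genModel (R := R) Gen.z ∈ core R :=
  Submodule.subset_span (Or.inl rfl)

end Core

/-! ### Basis commutators in the model -/

section Commutators

variable (R : Type*) [CommRing R]

/-- The image of `[z, c_I]` in the model. -/
noncomputable def zcModel (I : Finset ℕ) : Model R :=
  (I.sort (· ≤ ·)).foldl (fun u i => ⁅u, genModel (Gen.c i)⁆) (genModel Gen.z)

/-- The image of `[[z, c_{I₁}], …, [z, c_{Iₘ}]]` in the model. -/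
noncomputable def leftNormedModel : List (Finset ℕ) → Model R
  | [] => 0
  | I₁ :: Is => Is.foldl (fun u I => ⁅u, zcModel R I⁆) (zcModel R I₁)

variable {R}

theorem foldl_mem_core (l : List ℕ) {M : Model R} (hM : M ∈ core R) :
    l.foldl (fun u i => ⁅u, genModel (R := R) (Gen.c i)⁆) M ∈ core R := by
  induction l generalizing M with
  | nil => exact hM
  | cons i l ih =>
    refine ih ?_
    change ⁅M, genModel (R := R) (Gen.c i)⁆ ∈ core R
    rw [← lie_skew]
    exact neg_mem (lie_mem_core _ hM)

theorem zcModel_mem_core (I : Finset ℕ) : zcModel R I ∈ core R :=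
  foldl_mem_core _ genModel_z_mem_core

theorem foldl_mem_lastColumn (l : List ℕ) {M : Model R} (hM : M ∈ lastColumn R) :
    l.foldl (fun u i => ⁅u, genModel (R := R) (Gen.c i)⁆) M ∈ lastColumn R := by
  induction l generalizing M with
  | nil => exact hM
  | cons i l ih => exact ih (lie_mem_lastColumn' (genModel_mem_lastRowZero _) hM)

/-- Until index 0 occurs the commutator stays in `core`; bracketing with `c 0` puts it into the last
column, which all generators preserve. -/
theorem foldl_mem_lastColumn_of_mem (l : List ℕ) (h : 0 ∈ l) {M : Model R} (hM : M ∈ core R) :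
    l.foldl (fun u i => ⁅u, genModel (R := R) (Gen.c i)⁆) M ∈ lastColumn R := by
  induction l generalizing M with
  | nil => simp at h
  | cons i l ih =>
    rw [List.foldl_cons]
    by_cases hi : i = 0
    · subst hi
      exact foldl_mem_lastColumn l
        (lie_mem_lastColumn (core_le_lastRowZero hM) (scaled_matC_mem_lastColumn _))
    · refine ih ((List.mem_cons.mp h).resolve_left (Ne.symm hi)) ?_
      rw [← lie_skew]
      exact neg_mem (lie_mem_core _ hM)

theorem foldl_lie_zero {α B : Type*} [LieRing B] (f : α → B) (l : List α) :
    l.foldl (fun u i => ⁅u, f i⁆) 0 = 0 := by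
  induction l with
  | nil => rfl
  | cons i l ih => rw [List.foldl_cons, zero_lie, ih]

theorem lie_genModel_z_c (i : ℕ) :
    ⁅genModel (R := R) Gen.z, genModel (R := R) (Gen.c (i + 1))⁆
      = scaled (xi (i + 1)) (matX (i + 1).bodd) := by
  rw [genModel, genModel, lie_scaled_of_comm (by simp), matZ_lie_matD, one_mul]

theorem lie_genModel_z_c_c (i j : ℕ) :
    ⁅⁅genModel (R := R) Gen.z, genModel (R := R) (Gen.c (i + 1))⁆,
        genModel (R := R) (Gen.c (j + 1))⁆
      = scaled (xi (i + 1) * xi (j + 1)) (pairing (i + 1).bodd (j + 1).bodd • matP) := by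
  rw [lie_genModel_z_c, genModel, xi, xi, lie_scaled_of_anticomm (ι_mul_ι_comm _ _),
    matX_anti_matD]

theorem lie_genModel_z_c_c_c (i j k : ℕ) :
    ⁅⁅⁅genModel (R := R) Gen.z, genModel (R := R) (Gen.c (i + 1))⁆,
        genModel (R := R) (Gen.c (j + 1))⁆, genModel (R := R) (Gen.c (k + 1))⁆ = 0 := by
  rw [lie_genModel_z_c_c, genModel, lie_scaled_of_comm, smul_mul_assoc, mul_smul_comm,
    ← smul_sub, matP_lie_matD, smul_zero, scaled_zero]
  exact Subalgebra.mem_center_iff.mp (ι_mul_ι_mem_center _ _) _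

theorem zcModel_eq_zero {I : Finset ℕ} (h0 : 0 ∉ I) (hI : 2 < I.card) : zcModel R I = 0 := by
  rw [zcModel]
  have hl : ∀ i ∈ I.sort (· ≤ ·), i ≠ 0 := fun i hi h =>
    h0 (h ▸ (Finset.mem_sort (· ≤ ·)).mp hi)
  have hlen : 2 < (I.sort (· ≤ ·)).length := by rwa [Finset.length_sort]
  generalize I.sort (· ≤ ·) = l at hl hlen
  match l, hl, hlen with
  | i :: j :: k :: l, hl, _ =>
    obtain ⟨i, rfl⟩ := Nat.exists_eq_succ_of_ne_zero (hl i (by simp))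
    obtain ⟨j, rfl⟩ := Nat.exists_eq_succ_of_ne_zero (hl j (by simp))
    obtain ⟨k, rfl⟩ := Nat.exists_eq_succ_of_ne_zero (hl k (by simp))
    rw [List.foldl_cons, List.foldl_cons, List.foldl_cons, lie_genModel_z_c_c_c, foldl_lie_zero]

theorem IsHomog.foldl {α : Type*} (f : α → Model R) (d : α → ℤ) (hf : ∀ i, IsHomog (d i) (f i))
    (l : List α) {t : ℤ} {M : Model R} (hM : IsHomog t M) :
    IsHomog (t + (l.map d).sum) (l.foldl (fun u i => ⁅u, f i⁆) M) := by
  induction l generalizing t M with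
  | nil => simpa using hM
  | cons i l ih =>
    rw [List.map_cons, List.sum_cons, ← add_assoc]
    exact ih (hM.lie (hf i))

theorem isHomog_zcModel (I : Finset ℕ) : IsHomog ((I.card : ℤ) - 2) (zcModel R I) := by
  have := IsHomog.foldl (fun i => genModel (R := R) (Gen.c i)) (fun _ => 1) isHomog_genModel_c
    (I.sort (· ≤ ·)) isHomog_genModel_z
  rw [List.map_const', List.sum_replicate, Finset.length_sort, nsmul_one, neg_add_eq_sub] at this
  exact this

theorem isHomog_leftNormedModel (l : List (Finset ℕ)) :
    IsHomog (commType l) (leftNormedModel R l) := by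
  match l with
  | [] => intro i j _; rfl
  | I :: l =>
    have := IsHomog.foldl (zcModel R) (fun I => (I.card : ℤ) - 2) isHomog_zcModel l
      (isHomog_zcModel I)
    have h : ∀ l : List (Finset ℕ), (l.map fun I => (I.card : ℤ) - 2).sum
        = ((l.map Finset.card).sum : ℤ) - 2 * (l.length : ℤ) := by
      intro l
      induction l with
      | nil => simp
      | cons I l ih =>
        simp only [List.map_cons, List.sum_cons, List.length_cons, ih]
        push_cast
        ring
    rw [commType, ← h, List.map_cons, List.sum_cons]
    exact this

theorem foldl_zcModel_mem_lastColumn (l : List (Finset ℕ)) {M : Model R}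
    (hM : M ∈ lastColumn R) : l.foldl (fun u I => ⁅u, zcModel R I⁆) M ∈ lastColumn R := by
  induction l generalizing M with
  | nil => exact hM
  | cons I l ih => exact ih (lie_mem_lastColumn' (core_le_lastRowZero (zcModel_mem_core I)) hM)

theorem foldl_lie_eq_zero {α B : Type*} [LieRing B] (f : α → B) (l : List α) {i : α} (hi : i ∈ l)
    (h : f i = 0) (u : B) : l.foldl (fun u i => ⁅u, f i⁆) u = 0 := by
  induction l generalizing u with
  | nil => simp at hi
  | cons j l ih =>
    rw [List.foldl_cons]
    rcases List.mem_cons.mp hi with rfl | hi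
    · rw [h, lie_zero, foldl_lie_zero]
    · exact ih hi _

theorem leftNormedModel_eq_zero {l : List (Finset ℕ)} {I : Finset ℕ} (hI : I ∈ l)
    (h : zcModel R I = 0) : leftNormedModel R l = 0 := by
  match l with
  | J :: l =>
    rw [leftNormedModel]
    rcases List.mem_cons.mp hI with rfl | hI
    · rw [h, foldl_lie_zero]
    · exact foldl_lie_eq_zero _ _ hI h _

end Commutators

/-! ### The position of the least index in a basis commutator -/

section Order

/-- A word starting with the least letter can be preceded only by a nonempty word that also starts
with it. -/
theorem zero_mem_of_ltZ {I K : Finset ℕ} (h : ltZ I K) (h0 : 0 ∈ K) : 0 ∈ I := by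
  obtain ⟨hI, hIK⟩ := h
  have hlt := hIK.resolve_left (Finset.ne_empty_of_mem h0)
  by_contra hn
  have hK : 0 ∈ K.sort (· ≤ ·) := (Finset.mem_sort _).mpr h0
  have hI' : ∀ i ∈ I.sort (· ≤ ·), i ≠ 0 := fun i hi h =>
    hn (h ▸ (Finset.mem_sort (· ≤ ·)).mp hi)
  have hne : I.sort (· ≤ ·) ≠ [] := fun h => by
    have := Finset.length_sort (· ≤ ·) (s := I)
    rw [h, List.length_nil] at this
    exact hI.card_pos.ne this
  have hs := Finset.pairwise_sort K (· ≤ ·)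
  generalize I.sort (· ≤ ·) = a at hlt hI' hne
  generalize K.sort (· ≤ ·) = b at hlt hK hs
  match a, b, hlt, hI', hne, hK, hs with
  | i :: a, k :: b, hlt, hI', _, hK, hs =>
    have hk : k = 0 := by
      rcases List.mem_cons.mp hK with h | h
      · exact h.symm
      · exact Nat.le_zero.mp ((List.pairwise_cons.mp hs).1 0 h)
    have hi : i ≠ 0 := hI' i (by simp)
    rcases List.cons_lt_cons_iff.mp hlt with h | ⟨h, -⟩
    · omega
    · omega

theorem zero_notMem_of_leZ {I K : Finset ℕ} (h : leZ I K) (hd : Disjoint I K) : 0 ∉ K := by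
  intro h0
  rcases h with h | rfl
  · exact Finset.disjoint_left.mp hd (zero_mem_of_ltZ h h0) h0
  · exact Finset.disjoint_left.mp hd h0 h0

theorem zero_notMem_of_isChain {I : Finset ℕ} {l : List (Finset ℕ)}
    (hc : (I :: l).IsChain leZ) (hd : (I :: l).Pairwise Disjoint) : ∀ K ∈ l, 0 ∉ K := by
  induction l generalizing I with
  | nil => simp
  | cons K l ih =>
    rw [List.isChain_cons_cons] at hc
    rw [List.pairwise_cons] at hd
    intro K' hK'
    rcases List.mem_cons.mp hK' with rfl | h
    · exact zero_notMem_of_leZ hc.1 (hd.1 _ (by simp))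
    · exact ih hc.2 hd.2 K' h

/-- The second entry is minimal: if 0 lay in another entry it would also lie in the one just below
it in the order, against disjointness. -/
theorem IsBasic.zero_notMem {l : List (Finset ℕ)} (hl : IsBasic l) (hm : 2 ≤ l.length) {k : ℕ}
    (hk : k < l.length) (h1 : k ≠ 1) : 0 ∉ l[k] := by
  match l, hl, hm, k, hk, h1 with
  | I :: K :: l, hl, _, 0, _, _ =>
    obtain ⟨hd, hlt, -⟩ := hl
    exact zero_notMem_of_leZ (Or.inl hlt) ((List.pairwise_cons.mp hd).1 K (by simp)).symm
  | I :: K :: l, hl, _, k + 2, hk, _ =>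
    obtain ⟨hd, -, hc⟩ := hl
    exact zero_notMem_of_isChain hc (List.pairwise_cons.mp hd).2 _ (List.getElem_mem _)

end Order

/-! ### The generators of J vanish in the model -/

section Vanishing

variable {R : Type*} [CommRing R]

theorem leftNormedModel_eq_zero_of_badSize {l : List (Finset ℕ)} (hl : IsBasic l)
    (h : BadSize l) : leftNormedModel R l = 0 := by
  obtain ⟨hm, k, hk, h1, hcard⟩ := h
  exact leftNormedModel_eq_zero (List.getElem_mem hk)
    (zcModel_eq_zero (hl.zero_notMem hm hk h1) hcard)

theorem leftNormedModel_eq_zero_of_badType {l : List (Finset ℕ)} (h : BadType l) :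
    leftNormedModel R l = 0 := by
  obtain ⟨hne, ht⟩ := h
  match l with
  | [] => rfl
  | [I] =>
    -- A single nonempty set has type at least -1, so a bad type means more than 3 elements.
    have hI : 2 < I.card := by
      have : I.card ≠ 0 := fun h => hne (by rw [Finset.card_eq_zero.mp h])
      simp only [commType, List.map_cons, List.map_nil, List.sum_cons, List.sum_nil,
        List.length_cons, List.length_nil] at ht
      push_cast at ht
      omega
    by_cases h0 : 0 ∈ I
    · exact (isHomog_leftNormedModel [I]).eq_zero_of_mem_lastColumn
        (foldl_mem_lastColumn_of_mem _ ((Finset.mem_sort _).mpr h0) genModel_z_mem_core) ht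
    · exact zcModel_eq_zero h0 hI
  | I :: K :: l =>
    exact (isHomog_leftNormedModel _).eq_zero_of_mem_lastColumn
      (foldl_zcModel_mem_lastColumn l (core_lie_core (zcModel_mem_core I) (zcModel_mem_core K))) ht

end Vanishing

/-! ### The homomorphisms from F and L to the model -/

section Homomorphisms

variable (p : ℕ)

/-- The homomorphism from the free Lie algebra to the model. -/
noncomputable def modelFree : FreeL p →ₗ⁅ZMod p⁆ Model (ZMod p) :=
  FreeLieAlgebra.lift (ZMod p) genModel

@[simp]
theorem modelFree_of (g : Gen) : modelFree p (FreeLieAlgebra.of (ZMod p) g) = genModel g := by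
  rw [modelFree, FreeLieAlgebra.lift_of_apply]

theorem modelFree_mem_stabilizer (W : Submodule (ZMod p) (Model (ZMod p)))
    (h : ∀ g, ∀ M ∈ W, ⁅genModel (R := ZMod p) g, M⁆ ∈ W) (x : FreeL p) :
    modelFree p x ∈ stabilizer W :=
  freeLie_map_mem _ _ (fun g M hM => by rw [modelFree_of]; exact h g M hM) x

theorem modelFree_stabilizes_lastColumn (x : FreeL p) :
    modelFree p x ∈ stabilizer (lastColumn (ZMod p)) :=
  modelFree_mem_stabilizer p _ (fun g _ hM => lie_mem_lastColumn (genModel_mem_lastRowZero g) hM) x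

theorem modelFree_relF {x : FreeL p} (hx : x ∈ relF p) : modelFree p x = 0 := by
  -- With the zero subspace as target, `map_lie_ideal_mem` becomes a criterion for a commutator of
  -- ideals to be killed.
  have hbot : ∀ y, modelFree p y ∈ stabilizer (⊥ : Submodule (ZMod p) (Model (ZMod p))) := by
    intro y M hM
    rw [(Submodule.mem_bot _).mp hM, lie_zero]
    exact zero_mem _
  suffices relF p ≤ (modelFree p).ker from this hx
  refine sup_le (sup_le ?_ (iSup_le fun i => ?_)) ?_
  · intro y hy
    refine map_eq_zero_of_mem_lieSpan _ ?_ hy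
    rintro _ ⟨i, j, rfl⟩
    rw [LieHom.map_lie, modelFree_of, modelFree_of, genModel_c_lie_genModel_c]
  · intro y hy
    refine (Submodule.mem_bot _).mp (map_lie_ideal_mem (modelFree p) ⊥ hbot ?_ hy)
    intro a ha b hb
    rw [Submodule.mem_bot]
    match i with
    | 0 =>
      have key : ∀ a ∈ idealSpan (ZMod p) {FreeLieAlgebra.of (ZMod p) (Gen.c 0)},
          modelFree p a ∈ lastColumn (ZMod p) := fun a ha =>
        map_idealSpan_mem _ _ (modelFree_stabilizes_lastColumn p) (by
          rintro _ rfl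
          rw [modelFree_of]
          exact scaled_matC_mem_lastColumn _) ha
      exact lie_lastColumn (key a ha) (key b hb)
    | i + 1 =>
      have key : ∀ a ∈ idealSpan (ZMod p) {FreeLieAlgebra.of (ZMod p) (Gen.c (i + 1))},
          modelFree p a ∈ xiMultiples (ZMod p) (i + 1) := fun a ha =>
        map_idealSpan_mem _ _
          (modelFree_mem_stabilizer p _ fun g _ hM => lie_mem_xiMultiples _ _ hM) (by
          rintro _ rfl
          rw [modelFree_of]
          exact fun k l => ⟨(matD (i + 1).bodd k l : Grass (ZMod p)), rfl⟩) ha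
      exact lie_xiMultiples _ (key a ha) (key b hb)
  · intro y hy
    have hz : ∀ a ∈ idealSpan (ZMod p) {FreeLieAlgebra.of (ZMod p) Gen.z},
        modelFree p a ∈ core (ZMod p) := fun a ha =>
      map_idealSpan_mem _ _ (modelFree_mem_stabilizer p _ fun g _ hM => lie_mem_core g hM) (by
        rintro _ rfl
        rw [modelFree_of]
        exact genModel_z_mem_core) ha
    rw [LieAlgebra.derivedSeriesOfIdeal_succ, LieAlgebra.derivedSeriesOfIdeal_succ,
      LieAlgebra.derivedSeriesOfIdeal_zero] at hy
    refine (Submodule.mem_bot _).mp (map_lie_ideal_mem (modelFree p) ⊥ hbot ?_ hy)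
    intro a ha b hb
    have key : ∀ a ∈ ⁅idealSpan (ZMod p) {FreeLieAlgebra.of (ZMod p) Gen.z},
        idealSpan (ZMod p) {FreeLieAlgebra.of (ZMod p) Gen.z}⁆,
        modelFree p a ∈ lastColumn (ZMod p) := fun a ha =>
      map_lie_ideal_mem _ _ (modelFree_stabilizes_lastColumn p)
        (fun x hx y hy => core_lie_core (hz x hx) (hz y hy)) ha
    rw [Submodule.mem_bot]
    exact lie_lastColumn (key a ha) (key b hb)

/-- The homomorphism from `F` to the model. -/
noncomputable def modelF : F p →ₗ⁅ZMod p⁆ Model (ZMod p) :=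
  quotLift (relF p) (modelFree p) fun _ hx => modelFree_relF p hx

@[simp]
theorem modelF_genF (g : Gen) : modelF p (genF p g) = genModel g := modelFree_of p g

theorem modelF_zc (I : Finset ℕ) : modelF p (zc p I) = zcModel (ZMod p) I := by
  rw [zc, zcModel, ← modelF_genF p Gen.z]
  refine (List.foldl_hom (modelF p) fun u i => ?_).symm
  rw [LieHom.map_lie, modelF_genF]

theorem modelF_leftNormed (l : List (Finset ℕ)) :
    modelF p (leftNormed p l) = leftNormedModel (ZMod p) l := by
  match l with
  | [] => exact map_zero (modelF p)
  | I :: l =>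
    rw [leftNormed, leftNormedModel, ← modelF_zc p I]
    refine (List.foldl_hom (modelF p) fun u K => ?_).symm
    rw [LieHom.map_lie, modelF_zc]

theorem modelF_J {x : F p} (hx : x ∈ J p) : modelF p x = 0 := by
  refine map_eq_zero_of_mem_lieSpan _ ?_ hx
  rintro _ ⟨l, hl, h, rfl⟩
  rw [modelF_leftNormed]
  rcases h with h | h
  · exact leftNormedModel_eq_zero_of_badType h
  · exact leftNormedModel_eq_zero_of_badSize hl h

/-- The homomorphism from `L` to the model. -/
noncomputable def modelL : L p →ₗ⁅ZMod p⁆ Model (ZMod p) :=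
  quotLift (J p) (modelF p) fun _ hx => modelF_J p hx

/-- The image in `L` of the generator `c i`. -/
noncomputable def cL (i : ℕ) : L p := LieSubmodule.Quotient.mk (genF p (Gen.c i))

@[simp]
theorem modelL_zL : modelL p (zL p) = genModel Gen.z := modelF_genF p Gen.z

@[simp]
theorem modelL_cL (i : ℕ) : modelL p (cL p i) = genModel (Gen.c i) := modelF_genF p (Gen.c i)

end Homomorphisms

/-! ### Nonzero elements of every lower central term -/

section Nonnilpotent

variable (p : ℕ)

theorem lie_zL_mem (x : L p) (y : L p) (hy : y ∈ idealSpan (ZMod p) {zL p}) :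
    ⁅y, x⁆ ∈ idealSpan (ZMod p) {zL p} := lie_mem_left (ZMod p) (L p) _ _ _ hy

/-- The element `[z, c_{2k+1}, c_{2k+2}]` of the ideal generated by `z`. -/
noncomputable def pairElt (k : ℕ) : idealSpan (ZMod p) {zL p} :=
  ⟨⁅⁅zL p, cL p (2 * k + 1)⁆, cL p (2 * k + 2)⁆,
    lie_zL_mem p _ _ (lie_zL_mem p _ _ (LieSubmodule.subset_lieSpan rfl))⟩

/-- The commutator of `[z, c_0]` with the first `k` of the elements `pairElt`. -/
noncomputable def longElt : ℕ → idealSpan (ZMod p) {zL p}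
  | 0 => ⟨⁅zL p, cL p 0⁆, lie_zL_mem p _ _ (LieSubmodule.subset_lieSpan rfl)⟩
  | k + 1 => ⁅pairElt p k, longElt k⁆

theorem longElt_mem_lowerCentralSeries (k : ℕ) :
    longElt p k ∈ LieModule.lowerCentralSeries (ZMod p) (idealSpan (ZMod p) {zL p})
      (idealSpan (ZMod p) {zL p}) k := by
  induction k with
  | zero => exact LieSubmodule.mem_top _
  | succ k ih =>
    rw [LieModule.lowerCentralSeries_succ]
    exact LieSubmodule.lie_mem_lie (LieSubmodule.mem_top _) ih

/-- The indices of the `c_i` in `longElt`, apart from the first. -/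
def longIndices : ℕ → List ℕ
  | 0 => []
  | k + 1 => (2 * k + 1) :: (2 * k + 2) :: longIndices k

theorem le_of_mem_longIndices {k i : ℕ} (h : i ∈ longIndices k) : i ≤ 2 * k := by
  induction k with
  | zero => simp [longIndices] at h
  | succ k ih =>
    simp only [longIndices, List.mem_cons] at h
    rcases h with h | h | h
    · omega
    · omega
    · have := ih h
      omega

theorem nodup_longIndices (k : ℕ) : (longIndices k).Nodup := by
  induction k with
  | zero => exact List.nodup_nil
  | succ k ih =>
    rw [longIndices, List.nodup_cons, List.nodup_cons, List.mem_cons]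
    refine ⟨?_, fun h => ?_, ih⟩
    · rintro (h | h)
      · omega
      · have := le_of_mem_longIndices h
        omega
    · have := le_of_mem_longIndices h
      omega

/-- The image of `[z, c_0]` up to scalars. -/
def matU : Matrix (Fin 5) (Fin 5) ℤ :=
  !![0,0,0,0,1; 0,0,0,0,0; 0,0,0,0,0; 0,0,0,0,0; 0,0,0,0,0]

theorem modelL_pairElt (k : ℕ) :
    modelL p (pairElt p k) = scaled (xi (2 * k + 1) * xi (2 * k + 2)) (-matP) := by
  have h1 : (2 * k + 1).bodd = true := by simp
  have h2 : (2 * k + 1 + 1).bodd = false := by simp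
  rw [pairElt, LieHom.map_lie, LieHom.map_lie, modelL_zL, modelL_cL, modelL_cL,
    lie_genModel_z_c_c (2 * k) (2 * k + 1), h1, h2, pairing, neg_one_zsmul]

/-- `matP * matU = matU` and `matU * matP = 0`, so each new factor acts as the scalar `-(xi (2k+1) *
xi (2k+2))`; only the sign `n` changes otherwise. -/
theorem modelL_longElt (k : ℕ) :
    ∃ n : ℤ, (n = 1 ∨ n = -1) ∧
      modelL p (longElt p k) = scaled (((longIndices k).map xi).prod) (n • matU) := by
  induction k with
  | zero =>
    have h : matZ * matC - matC * matZ = matU := by decide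
    refine ⟨1, Or.inl rfl, ?_⟩
    rw [longElt, LieHom.map_lie, modelL_zL, modelL_cL, genModel, genModel,
      lie_scaled_of_comm rfl, h, one_mul, one_zsmul, longIndices, List.map_nil, List.prod_nil]
  | succ k ih =>
    obtain ⟨n, hn, ih⟩ := ih
    have h : matP * matU = matU := by decide
    have h' : matU * matP = 0 := by decide
    have hc : ((longIndices k).map (xi (R := ZMod p))).prod * (xi (2 * k + 1) * xi (2 * k + 2))
        = xi (2 * k + 1) * xi (2 * k + 2) * ((longIndices k).map xi).prod :=
      Subalgebra.mem_center_iff.mp (ι_mul_ι_mem_center _ _) _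
    refine ⟨-n, by omega, ?_⟩
    change modelL p ⁅(pairElt p k : L p), (longElt p k : L p)⁆ = _
    rw [LieHom.map_lie, modelL_pairElt, ih,
      lie_scaled_of_comm hc, neg_mul,
      mul_neg, mul_smul_comm, smul_mul_assoc, h, h', smul_zero, neg_zero, sub_zero, longIndices,
      List.map_cons, List.map_cons, List.prod_cons, List.prod_cons, mul_assoc, neg_smul]

theorem longElt_ne_zero (hp : p.Prime) (k : ℕ) : longElt p k ≠ 0 := by
  have : Fact p.Prime := ⟨hp⟩
  intro h
  obtain ⟨n, hn, hk⟩ := modelL_longElt p k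
  rw [h, LieSubmodule.coe_zero, map_zero] at hk
  -- The only nonzero entry of `matU`; it is ± the Grassmann product.
  have := congrFun (congrFun hk 0) 4
  apply xi_prod_ne_zero (R := ZMod p) _ (nodup_longIndices k)
  rcases hn with rfl | rfl <;> simpa [scaled_apply, matU] using this.symm

end Nonnilpotent

end EngelLie

theorem theorem4p2 (p : ℕ) (hp : p.Prime) (hodd : Odd p) :
    ¬ LieRing.IsNilpotent (EngelLie.idealSpan (ZMod p) {EngelLie.zL p}) := by
  intro h
  obtain ⟨k, hk⟩ := (LieModule.isNilpotent_iff (ZMod p) _ _).mp h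
  apply EngelLie.longElt_ne_zero p hp k
  have := EngelLie.longElt_mem_lowerCentralSeries p k
  rwa [hk, LieSubmodule.mem_bot] at this
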